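/- For $\kappa>0$ and $D\in\mathbb N$ let $\mathbb L^D_\kappa=\{z=(z_1,\bar z)\in\mathbb R\times\mathbb R^{D} : z\circ z=-1/\kappa,\ z_1>0\}$, where $x\circ y=-x_1y_1+\bar x^{\top}\bar y$, with distance $d(x,y)=\kappa^{-1/2}\operatorname{arccosh}(-\kappa\, x\circ y)$ and origin $o=(1/\sqrt\kappa,0,\dots,0)$. The Lorentz linear layer of Chen et al. with weight matrix $W\in\mathbb R^{D_{\rm out}\times(D_{\rm in}+1)}$ maps $x\in\mathbb L^{D_{\rm in}}_\kappa$ to $$\Phi_W(x)=\Big(\sqrt{\|Wx\|^2+1/\kappa},\;Wx\Big)\in\mathbb L^{D_{\rm out}}_\kappa .$$ Let $T_{m,h}$ be the complete $m$-ary tree of depth $h$ with its graph distance $d_T$. A map $f$ from the nodes of $T_{m,h}$ to $\mathbb L^{D}_\kappa$ has distortion at most $\lambda$ if there is a scale $s>0$ with $s\,d_T(u,v)\le d(f(u),f(v))\le \lambda s\,d_T(u,v)$ for all nodes $u,v$. Fix $\delta>0$ and real numbers $\omega,r$. We say that the layer embeds $T_{m,h}$ with distortion at most $\lambda$ after $n$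 updates if there are weight matrices $W_0,W_1,\dots,W_n$ with $\|W_0\|_F\le\omega$ and $\|W_{t+1}-W_t\|_F\le\delta$ for all $t<n$, and input points $x_v\in\mathbb L^{D_{\rm in}}_\kappa$ with $d(x_v,o)\le r$, one for each node $v$, such that $v\mapsto\Phi_{W_n}(x_v)$ has distortion at most $\lambda$. **Proposition.** The number of (norm-bounded) gradient updates that the layer needs to embed a hierarchy of depth $h$ with low distortion is $\Omega(e^h)$, and for every fixed bound on the distortion it grows exponentially in $h$. Precisely: 1. For all $\kappa,\delta>0$ and $\omega,r\in\mathbb R$ there are $c>0$ and $h_0\in\mathbb N$ such that for all $\lambda\in[1,\tfrac{11}{10}]$, all $D_{\rm in},D_{\rm out},n$, all $m\ge2$ and all $h\ge h_0$: if the layer embeds $T_{m,h}$ with distortion at most $\lambda$ after $n$ updates, then $n\ge c\,e^{h}$. 2. For every $\lambda\ge1$ and $D_{\rm out}$ there is $a>0$ such that for all $\kappa,\delta>0$ and $\omega,r\in\mathbb R$ there are $c>0$ and $h_0\in\mathbb N$ such that for all $D_{\rm in},n$, all $m\ge2$ and all $h\ge h_0$: if the layer embeds $T_{m,h}$ with distortion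 at most $\lambda$ after $n$ updates, then $n\ge c\,e^{ah}$. -/

import Mathlib

attribute [local instance] Matrix.frobeniusNormedAddCommGroup

/-- Lorentz inner product on `ℝ^{D+1}`; coordinate `0` is the time component. -/
def lorentzInner {D : ℕ} (x y : Fin (D + 1) → ℝ) : ℝ :=
  -(x 0 * y 0) + ∑ i : Fin D, x i.succ * y i.succ

/-- The upper sheet of the hyperboloid, of constant curvature `-κ` (for `0 < κ`). -/
def lorentzSpace (κ : ℝ) (D : ℕ) : Set (Fin (D + 1) → ℝ) :=
  {z | lorentzInner z z = -1 / κ ∧ 0 < z 0}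

/-- Geodesic distance of the Lorentz model. -/
noncomputable def lorentzDist (κ : ℝ) {D : ℕ} (x y : Fin (D + 1) → ℝ) : ℝ :=
  1 / √κ * Real.arcosh (-κ * lorentzInner x y)

/-- The origin `(1/√κ, 0, …, 0)` of the Lorentz model. -/
noncomputable def lorentzOrigin (κ : ℝ) (D : ℕ) : Fin (D + 1) → ℝ :=
  Fin.cons (1 / √κ) 0

/-- The Lorentz linear layer of Chen et al.: the spatial part of the output is `W x`, and the
time component is chosen so that the output lies on the hyperboloid. -/
noncomputable def chenLayer (κ : ℝ) {Din Dout : ℕ}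
    (W : Matrix (Fin Dout) (Fin (Din + 1)) ℝ) (x : Fin (Din + 1) → ℝ) : Fin (Dout + 1) → ℝ :=
  Fin.cons (√(∑ i, (W.mulVec x i) ^ 2 + 1 / κ)) (W.mulVec x)

theorem lorentzOrigin_mem {κ : ℝ} (hκ : 0 < κ) (D : ℕ) :
    lorentzOrigin κ D ∈ lorentzSpace κ D := by
  have h := Real.mul_self_sqrt hκ.le
  have h' : 0 < √κ := Real.sqrt_pos.2 hκ
  refine ⟨?_, ?_⟩
  · simp only [lorentzInner, lorentzOrigin, Fin.cons_zero, Fin.cons_succ, Pi.zero_apply,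
      mul_zero, Finset.sum_const_zero, add_zero]
    rw [div_mul_div_comm, h, neg_div, one_mul]
  · simpa [lorentzOrigin] using hκ

theorem chenLayer_mem {κ : ℝ} (hκ : 0 < κ) {Din Dout : ℕ}
    (W : Matrix (Fin Dout) (Fin (Din + 1)) ℝ) (x : Fin (Din + 1) → ℝ) :
    chenLayer κ W x ∈ lorentzSpace κ Dout := by
  have h1 : 0 ≤ ∑ i, (W.mulVec x i) ^ 2 := Finset.sum_nonneg fun i _ => sq_nonneg _
  have h2 : 0 < 1 / κ := by positivity
  refine ⟨?_, ?_⟩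
  · simp only [lorentzInner, chenLayer, Fin.cons_zero, Fin.cons_succ]
    rw [Real.mul_self_sqrt (by linarith)]
    simp only [← pow_two]
    ring
  · simp only [chenLayer, Fin.cons_zero]
    exact Real.sqrt_pos.2 (by linarith)

/-- Nodes of the complete `m`-ary tree of depth `h`: words of length at most `h` in `m` letters.
The root is the empty word, and the depth of a node is its length. -/
abbrev TreeNode (m h : ℕ) : Type := {l : List (Fin m) // l.length ≤ h}

/-- The complete `m`-ary tree of depth `h`: the children of `l` are the words `a :: l`. -/
def completeTree (m h : ℕ) : SimpleGraph (TreeNode m h) where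
  Adj u v := (∃ a, v.1 = a :: u.1) ∨ (∃ a, u.1 = a :: v.1)
  symm := ⟨fun _ _ huv => huv.symm⟩
  loopless := ⟨fun u hu => by
    rcases hu with ⟨a, ha⟩ | ⟨a, ha⟩ <;> simpa using congrArg List.length ha⟩

/-- The map `f` from the nodes of `G` into the Lorentz model embeds `G` with distortion at most
`lam`: up to a scale `s`, it preserves all graph distances up to the factor `lam`. -/
def HasDistortionLE (κ lam : ℝ) {V : Type} (G : SimpleGraph V) {D : ℕ}
    (f : V → Fin (D + 1) → ℝ) : Prop :=
  ∃ s : ℝ, 0 < s ∧ ∀ u v : V,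
    s * (G.dist u v : ℝ) ≤ lorentzDist κ (f u) (f v) ∧
      lorentzDist κ (f u) (f v) ≤ lam * s * (G.dist u v : ℝ)

/-- Some run of `n` weight updates, each of Frobenius norm at most `δ`, from initial weights of
Frobenius norm at most `ω`, makes the layer embed the complete `m`-ary tree of depth `h` with
distortion at most `lam`, where the node `v` is fed to the layer as some input point `x v` of
hyperbolic norm at most `r`. -/
def ChenEmbedsTree (κ δ ω r lam : ℝ) (Din Dout m h n : ℕ) : Prop :=
  ∃ (W : ℕ → Matrix (Fin Dout) (Fin (Din + 1)) ℝ) (x : TreeNode m h → Fin (Din + 1) → ℝ),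
    ‖W 0‖ ≤ ω ∧
    (∀ t < n, ‖W (t + 1) - W t‖ ≤ δ) ∧
    (∀ v, x v ∈ lorentzSpace κ Din ∧ lorentzDist κ (x v) (lorentzOrigin κ Din) ≤ r) ∧
    HasDistortionLE κ lam (completeTree m h) (fun v => chenLayer κ (W n) (x v))

open Real

/-! ### Hyperbolic functions -/

/-! After rescaling to curvature `-1`, the embedding has some scale `σ`. Two leaves at graph
distance `2 * h` must then land at hyperbolic distance at least `2 * σ * h`. Since `-lorentzInner`
is at most twice the product of the time coordinates, one output has time coordinate of order at
least `exp (σ * h)`. Inputs in a fixed ball give outputs whose time coordinate is at most affine in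
`‖W n‖`, hence affine in `n` (`exp_le_of_scale`).

It remains to keep `σ` away from `0`: at small scale hyperbolic space is nearly Euclidean, and trees
embed badly there. For distortion at most `11 / 10`, a single vertex with three neighbours already
forces `σ > 1` in any dimension (`one_lt_of_star`). For arbitrary distortion in fixed dimension,
exponentially many nodes cannot be separated in a ball with room for only polynomially many
(`exists_le_scale`). -/

theorem one_add_half_sq_le_cosh (x : ℝ) : 1 + x ^ 2 / 2 ≤ cosh x := by
  rw [← cosh_abs, ← sq_abs x]
  have h0 := abs_nonneg x
  have h1 : |x| / 2 ≤ sinh (|x| / 2) := self_le_sinh_iff.2 (by linarith)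
  have h2 : cosh |x| = 1 + 2 * sinh (|x| / 2) ^ 2 := by
    have h := cosh_two_mul (|x| / 2)
    rw [cosh_sq, mul_div_cancel₀ _ (two_ne_zero)] at h
    linarith
  rw [h2]
  nlinarith

theorem add_cube_div_six_le_sinh {x : ℝ} (hx : 0 ≤ x) : x + x ^ 3 / 6 ≤ sinh x := by
  have h := sum_le_hasSum (Finset.range 2) (fun n _ => by positivity) (hasSum_sinh x)
  refine le_of_eq_of_le ?_ h
  norm_num [Finset.sum_range_succ, Nat.factorial]

theorem cosh_sq_sub_one_le {x : ℝ} (h0 : 0 ≤ x) (h1 : x ≤ 1) : cosh x ^ 2 - 1 ≤ (2 * x) ^ 2 := by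
  have h2 : cosh x ^ 2 ≤ exp (x ^ 2) := by
    calc cosh x ^ 2 ≤ exp (x ^ 2 / 2) ^ 2 :=
          pow_le_pow_left₀ (cosh_pos x).le (cosh_le_exp_half_sq x) 2
      _ = exp (x ^ 2) := by rw [← exp_nat_mul]; congr 1; push_cast; ring
  have h3 : x ^ 2 ≤ 1 := by nlinarith
  have h4 := abs_le.1 (abs_exp_sub_one_sub_id_le (x := x ^ 2) (by rwa [abs_of_nonneg (sq_nonneg x)]))
  nlinarith [h4.2, sq_nonneg x]

theorem cosh_le_quartic {x : ℝ} (h0 : 0 ≤ x) (h1 : x ≤ 1) :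
    cosh x ≤ 1 + x ^ 2 / 2 + x ^ 4 / 8 + x ^ 6 / 36 := by
  refine (cosh_le_exp_half_sq x).trans ?_
  have h := exp_bound' (x := x ^ 2 / 2) (by positivity) (by nlinarith) (n := 3) (by norm_num)
  refine h.trans (le_of_eq ?_)
  simp [Finset.sum_range_succ, Nat.factorial]
  ring

/-- This inequality is what the three-leaf star must violate when its scale is at most `1`. The
proof bounds the ratio of the two `sinh` values by `1.151`, just below `2 / √3 ≈ 1.1547`. -/
theorem sinh_mul_lt {x : ℝ} (h0 : 0 < x) (h1 : x ≤ 1) :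
    3 * sinh (11 / 10 * x) ^ 2 < 4 * sinh x ^ 2 := by
  have hs := add_cube_div_six_le_sinh h0.le
  have hc := cosh_le_quartic h0.le h1
  have hc1 := cosh_le_quartic (x := x / 10) (by positivity) (by linarith)
  have hs0 : 0 < sinh x := sinh_pos_iff.2 h0
  have hx2 : x ^ 2 ≤ 1 := by nlinarith
  have hx4 : x ^ 4 ≤ x ^ 2 := by nlinarith [sq_nonneg x]
  have hx6 : x ^ 6 ≤ x ^ 2 := by nlinarith [sq_nonneg x, sq_nonneg (x ^ 2)]
  have hc2 : cosh (x / 10) ≤ 1.0051 := by nlinarith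
  have hs1 : sinh (x / 10) ≤ 0.1004 * x := by
    have h := cosh_sq (x / 10)
    have h5 : cosh (x / 10) ≤ 1 + 0.00502 * x ^ 2 := by nlinarith
    have h6 : cosh (x / 10) ^ 2 ≤ (1 + 0.00502 * x ^ 2) ^ 2 :=
      pow_le_pow_left₀ (cosh_pos _).le h5 2
    refine abs_le_of_sq_le_sq' (b := 0.1004 * x) ?_ (by positivity) |>.2
    nlinarith
  have hxc : x * cosh x ≤ 1.45 * sinh x := by
    have : cosh x ≤ 1.45 * (1 + x ^ 2 / 6) := by nlinarith
    nlinarith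
  -- By the addition formula the ratio is at most `1.0051 + 0.1004 * 1.45 < 1.151`.
  have key : sinh (11 / 10 * x) ≤ 1.151 * sinh x := by
    rw [show 11 / 10 * x = x + x / 10 by ring, sinh_add]
    have hcx := cosh_pos x
    nlinarith [mul_le_mul_of_nonneg_left hc2 hs0.le, mul_le_mul_of_nonneg_left hs1 hcx.le]
  have hp : 0 < sinh (11 / 10 * x) := sinh_pos_iff.2 (by positivity)
  nlinarith

/-! ### The Lorentz form -/

theorem lorentzInner_comm {D : ℕ} (x y : Fin (D + 1) → ℝ) :
    lorentzInner x y = lorentzInner y x := by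
  simp only [lorentzInner, mul_comm]

theorem lorentzInner_add_left {D : ℕ} (x y z : Fin (D + 1) → ℝ) :
    lorentzInner (x + y) z = lorentzInner x z + lorentzInner y z := by
  simp only [lorentzInner, Pi.add_apply, add_mul, Finset.sum_add_distrib]
  ring

theorem lorentzInner_add_right {D : ℕ} (x y z : Fin (D + 1) → ℝ) :
    lorentzInner x (y + z) = lorentzInner x y + lorentzInner x z := by
  rw [lorentzInner_comm, lorentzInner_add_left, lorentzInner_comm y, lorentzInner_comm z]

theorem lorentzInner_smul_left {D : ℕ} (c : ℝ) (x y : Fin (D + 1) → ℝ) :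
    lorentzInner (c • x) y = c * lorentzInner x y := by
  simp only [lorentzInner, Pi.smul_apply, smul_eq_mul, mul_add, Finset.mul_sum]
  congr 1
  · ring
  · exact Finset.sum_congr rfl fun i _ => by ring

theorem lorentzInner_smul_right {D : ℕ} (c : ℝ) (x y : Fin (D + 1) → ℝ) :
    lorentzInner x (c • y) = c * lorentzInner x y := by
  rw [lorentzInner_comm, lorentzInner_smul_left, lorentzInner_comm]

theorem lorentzInner_sub_left {D : ℕ} (x y z : Fin (D + 1) → ℝ) :
    lorentzInner (x - y) z = lorentzInner x z - lorentzInner y z := by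
  simp only [lorentzInner, Pi.sub_apply, sub_mul, Finset.sum_sub_distrib]
  ring

theorem lorentzInner_sub_right {D : ℕ} (x y z : Fin (D + 1) → ℝ) :
    lorentzInner x (y - z) = lorentzInner x y - lorentzInner x z := by
  rw [lorentzInner_comm, lorentzInner_sub_left, lorentzInner_comm y, lorentzInner_comm z]

/-- The spatial part of the boost that moves the unit timelike vector `p` to the time axis. -/
noncomputable def boostSpatial {D : ℕ} (p v : Fin (D + 1) → ℝ) (i : Fin D) : ℝ :=
  v i.succ - (v 0 - lorentzInner p v) / (1 + p 0) * p i.succ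

theorem boostSpatial_sub {D : ℕ} (p v w : Fin (D + 1) → ℝ) (i : Fin D) :
    boostSpatial p (v - w) i = boostSpatial p v i - boostSpatial p w i := by
  simp only [boostSpatial, lorentzInner_sub_right, Pi.sub_apply]
  ring

/-- The right side is the Lorentz square of `v + ⟨p, v⟩ p`, the projection to the spacelike
complement of `p`. This gives linear Euclidean coordinates centred at `p`, in which a point at
distance `d` has norm `sinh d`. -/
theorem sum_boostSpatial_sq {D : ℕ} {p : Fin (D + 1) → ℝ} (hp : p ∈ lorentzSpace 1 D)
    (v : Fin (D + 1) → ℝ) :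
    ∑ i, boostSpatial p v i ^ 2 = lorentzInner v v + lorentzInner p v ^ 2 := by
  obtain ⟨h1, h0⟩ := hp
  have expand : ∀ c : ℝ, ∑ i : Fin D, (v i.succ - c * p i.succ) ^ 2 =
      ∑ i : Fin D, v i.succ * v i.succ - 2 * c * ∑ i : Fin D, p i.succ * v i.succ +
        c ^ 2 * ∑ i : Fin D, p i.succ * p i.succ := by
    intro c
    simp only [Finset.mul_sum, ← Finset.sum_sub_distrib, ← Finset.sum_add_distrib]
    exact Finset.sum_congr rfl fun i _ => by ring
  simp only [boostSpatial, expand]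
  simp only [lorentzInner] at h1 ⊢
  have hP : ∑ i : Fin D, p i.succ * p i.succ = p 0 * p 0 - 1 := by linarith
  rw [hP]
  have : 1 + p 0 ≠ 0 := by positivity
  field_simp
  ring

theorem one_le_time {D : ℕ} {p : Fin (D + 1) → ℝ} (hp : p ∈ lorentzSpace 1 D) : 1 ≤ p 0 := by
  obtain ⟨h1, h0⟩ := hp
  have h2 : 0 ≤ ∑ i : Fin D, p i.succ * p i.succ :=
    Finset.sum_nonneg fun i _ => mul_self_nonneg _
  simp only [lorentzInner] at h1
  nlinarith

theorem spatial_inner_abs_le {D : ℕ} {p q : Fin (D + 1) → ℝ} (hp : p ∈ lorentzSpace 1 D)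
    (hq : q ∈ lorentzSpace 1 D) : |∑ i : Fin D, p i.succ * q i.succ| ≤ p 0 * q 0 - 1 := by
  have hp0 := one_le_time hp
  have hq0 := one_le_time hq
  have h := Finset.sum_mul_sq_le_sq_mul_sq Finset.univ (fun i : Fin D => p i.succ)
    (fun i : Fin D => q i.succ)
  have hp1 := hp.1
  have hq1 := hq.1
  simp only [lorentzInner] at hp1 hq1
  simp only [pow_two] at h
  refine abs_le_of_sq_le_sq ?_ (by nlinarith)
  rw [show ∑ i : Fin D, p i.succ * p i.succ = p 0 * p 0 - 1 by linarith,
    show ∑ i : Fin D, q i.succ * q i.succ = q 0 * q 0 - 1 by linarith] at h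
  -- `(p₀q₀ - 1)² - (p₀² - 1)(q₀² - 1) = (p₀ - q₀)²`.
  nlinarith [sq_nonneg (p 0 - q 0)]

theorem one_le_neg_lorentzInner {D : ℕ} {p q : Fin (D + 1) → ℝ} (hp : p ∈ lorentzSpace 1 D)
    (hq : q ∈ lorentzSpace 1 D) : 1 ≤ -lorentzInner p q := by
  have h := (abs_le.1 (spatial_inner_abs_le hp hq)).2
  simp only [lorentzInner]
  linarith

theorem neg_lorentzInner_le {D : ℕ} {p q : Fin (D + 1) → ℝ} (hp : p ∈ lorentzSpace 1 D)
    (hq : q ∈ lorentzSpace 1 D) : -lorentzInner p q ≤ 2 * (p 0 * q 0) := by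
  have h := (abs_le.1 (spatial_inner_abs_le hp hq)).1
  simp only [lorentzInner]
  linarith

theorem sqrt_smul_mem_lorentzSpace {κ : ℝ} (hκ : 0 < κ) {D : ℕ} {z : Fin (D + 1) → ℝ}
    (hz : z ∈ lorentzSpace κ D) : √κ • z ∈ lorentzSpace 1 D := by
  refine ⟨?_, ?_⟩
  · rw [lorentzInner_smul_left, lorentzInner_smul_right, hz.1, ← mul_assoc, mul_self_sqrt hκ.le]
    field_simp
  · exact mul_pos (sqrt_pos.2 hκ) hz.2

theorem sqrt_mul_lorentzDist {κ : ℝ} (hκ : 0 < κ) {D : ℕ} (x y : Fin (D + 1) → ℝ) :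
    √κ * lorentzDist κ x y = arcosh (-lorentzInner (√κ • x) (√κ • y)) := by
  have h : √κ ≠ 0 := (sqrt_pos.2 hκ).ne'
  rw [lorentzDist, lorentzInner_smul_left, lorentzInner_smul_right, ← mul_assoc √κ √κ,
    mul_self_sqrt hκ.le, neg_mul]
  field_simp

theorem neg_lorentzInner_eq_cosh {κ : ℝ} (hκ : 0 < κ) {D : ℕ} {x y : Fin (D + 1) → ℝ}
    (hx : x ∈ lorentzSpace κ D) (hy : y ∈ lorentzSpace κ D) :
    -lorentzInner (√κ • x) (√κ • y) = cosh (√κ * lorentzDist κ x y) := by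
  rw [sqrt_mul_lorentzDist hκ, cosh_arcosh]
  exact one_le_neg_lorentzInner (sqrt_smul_mem_lorentzSpace hκ hx)
    (sqrt_smul_mem_lorentzSpace hκ hy)

theorem lorentzDist_nonneg {κ : ℝ} (hκ : 0 < κ) {D : ℕ} {x y : Fin (D + 1) → ℝ}
    (hx : x ∈ lorentzSpace κ D) (hy : y ∈ lorentzSpace κ D) : 0 ≤ lorentzDist κ x y := by
  have h : 0 ≤ √κ * lorentzDist κ x y := by
    rw [sqrt_mul_lorentzDist hκ]
    exact arcosh_nonneg (one_le_neg_lorentzInner (sqrt_smul_mem_lorentzSpace hκ hx)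
      (sqrt_smul_mem_lorentzSpace hκ hy))
  exact nonneg_of_mul_nonneg_right h (sqrt_pos.2 hκ)

/-- A map of distortion at most `lam` into the Lorentz model, rescaled to curvature `-1`. -/
theorem HasDistortionLE.exists_scale {κ lam : ℝ} (hκ : 0 < κ) {V : Type} {G : SimpleGraph V}
    {D : ℕ} {f : V → Fin (D + 1) → ℝ} (hf : ∀ v, f v ∈ lorentzSpace κ D)
    (h : HasDistortionLE κ lam G f) :
    ∃ σ : ℝ, 0 < σ ∧ ∀ u v,
      cosh (σ * G.dist u v) ≤ -lorentzInner (√κ • f u) (√κ • f v) ∧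
        -lorentzInner (√κ • f u) (√κ • f v) ≤ cosh (lam * σ * G.dist u v) := by
  obtain ⟨s, hs, h⟩ := h
  have hk := sqrt_pos.2 hκ
  refine ⟨√κ * s, mul_pos hk hs, fun u v => ?_⟩
  have hd := lorentzDist_nonneg hκ (hf u) (hf v)
  rw [neg_lorentzInner_eq_cosh hκ (hf u) (hf v), cosh_le_cosh, cosh_le_cosh,
    abs_of_nonneg (by positivity), abs_of_nonneg (mul_nonneg hk.le hd)]
  refine ⟨?_, le_trans ?_ (le_abs_self _)⟩
  · rw [mul_assoc]
    exact mul_le_mul_of_nonneg_left (h u v).1 hk.le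
  · rw [show lam * (√κ * s) * (G.dist u v : ℝ) = √κ * (lam * s * G.dist u v) by ring]
    exact mul_le_mul_of_nonneg_left (h u v).2 hk.le

/-! ### Stars with three leaves -/

/-- The projection of `q₁ + q₂ + q₃` orthogonal to `p` has nonnegative square, so `0 ≤ -3 - 6 cosh
(2σ) + 9 cosh² (1.1σ) = 9 sinh² (1.1σ) - 12 sinh² σ`. For `σ ≤ 1` this contradicts `sinh_mul_lt`. -/
theorem one_lt_of_star {D : ℕ} {p q₁ q₂ q₃ : Fin (D + 1) → ℝ} {σ : ℝ} (hσ : 0 < σ)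
    (hp : p ∈ lorentzSpace 1 D) (h₁ : q₁ ∈ lorentzSpace 1 D) (h₂ : q₂ ∈ lorentzSpace 1 D)
    (h₃ : q₃ ∈ lorentzSpace 1 D)
    (hp₁ : -lorentzInner p q₁ ≤ cosh (11 / 10 * σ)) (hp₂ : -lorentzInner p q₂ ≤ cosh (11 / 10 * σ))
    (hp₃ : -lorentzInner p q₃ ≤ cosh (11 / 10 * σ)) (h₁₂ : cosh (2 * σ) ≤ -lorentzInner q₁ q₂)
    (h₁₃ : cosh (2 * σ) ≤ -lorentzInner q₁ q₃) (h₂₃ : cosh (2 * σ) ≤ -lorentzInner q₂ q₃) :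
    1 < σ := by
  by_contra! hle
  have key := sum_boostSpatial_sq hp (q₁ + q₂ + q₃)
  have h0 : 0 ≤ ∑ i, boostSpatial p (q₁ + q₂ + q₃) i ^ 2 := Finset.sum_nonneg fun i _ => sq_nonneg _
  rw [key] at h0
  simp only [lorentzInner_add_left, lorentzInner_add_right, lorentzInner_comm q₂ q₁,
    lorentzInner_comm q₃ q₁, lorentzInner_comm q₃ q₂, h₁.1, h₂.1, h₃.1] at h0
  have hsq : (lorentzInner p q₁ + lorentzInner p q₂ + lorentzInner p q₃) ^ 2 ≤
      (3 * cosh (11 / 10 * σ)) ^ 2 := by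
    have := one_le_neg_lorentzInner hp h₁
    have := one_le_neg_lorentzInner hp h₂
    have := one_le_neg_lorentzInner hp h₃
    rw [← neg_sq]
    exact pow_le_pow_left₀ (by linarith) (by linarith) 2
  have h4 := sinh_mul_lt hσ hle
  have h5 := cosh_sq (11 / 10 * σ)
  have h6 := cosh_two_mul σ
  have h7 := cosh_sq σ
  nlinarith

/-! ### Packing -/

/-- Pigeonhole on a cubic grid of side `τ / (D + 1)`: two points in one cell have squared distance
at most `D τ² / (D + 1)² < τ²`, which also covers `D = 0`. -/
theorem card_le_of_separated_of_bounded {ι : Type*} [Fintype ι] {D N : ℕ} (w : ι → Fin D → ℝ)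
    {R τ : ℝ} (hτ : 0 < τ) (hR : 0 ≤ R) (hN : R * (D + 1) / τ ≤ N)
    (hb : ∀ a, ∑ i, w a i ^ 2 ≤ R ^ 2)
    (hsep : ∀ a b, a ≠ b → τ ^ 2 ≤ ∑ i, (w a i - w b i) ^ 2) :
    Fintype.card ι ≤ (2 * N + 1) ^ D := by
  have hcoord : ∀ a i, |w a i| ≤ R := fun a i =>
    abs_le_of_sq_le_sq ((Finset.single_le_sum (f := fun i => w a i ^ 2)
      (fun i _ => sq_nonneg _) (Finset.mem_univ i)).trans (hb a)) hR
  let M : ℝ := (D + 1) / τ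
  have hM : 0 < M := by positivity
  have hmem : ∀ a i, ⌊w a i * M⌋ ∈ Finset.Icc (-(N : ℤ)) N := by
    intro a i
    have h1 := abs_le.1 (hcoord a i)
    have h2 : R * M ≤ N := by simpa [M, mul_div_assoc] using hN
    rw [Finset.mem_Icc]
    constructor
    · rw [Int.le_floor]
      push_cast
      nlinarith
    · have : ((⌊w a i * M⌋ : ℤ) : ℝ) ≤ (N : ℤ) :=
        (Int.floor_le _).trans (by push_cast; nlinarith)
      exact_mod_cast this
  let g : ι → Fin D → Finset.Icc (-(N : ℤ)) N := fun a i => ⟨⌊w a i * M⌋, hmem a i⟩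
  have hg : Function.Injective g := by
    intro a b hab
    by_contra hne
    have hi : ∀ i, (w a i - w b i) ^ 2 ≤ (τ / (D + 1)) ^ 2 := by
      intro i
      have h1 : ⌊w a i * M⌋ = ⌊w b i * M⌋ := congrArg Subtype.val (congrFun hab i)
      have h2 := Int.abs_sub_lt_one_of_floor_eq_floor h1
      rw [← sub_mul, abs_mul, abs_of_pos hM] at h2
      rw [← sq_abs]
      refine pow_le_pow_left₀ (abs_nonneg _) ?_ 2
      have h3 : τ / (D + 1) = 1 / M := by simp [M]
      rw [h3, le_div_iff₀ hM]
      exact h2.le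
    have h1 := (hsep a b hne).trans (Finset.sum_le_sum fun i _ => hi i)
    simp only [Finset.sum_const, Finset.card_univ, Fintype.card_fin, nsmul_eq_mul] at h1
    rw [div_pow, ← mul_div_assoc, le_div_iff₀ (by positivity)] at h1
    have hD : (0 : ℝ) ≤ D := Nat.cast_nonneg D
    have : 0 < τ ^ 2 := by positivity
    nlinarith [mul_nonneg this.le hD, mul_nonneg (mul_nonneg this.le hD) hD]
  have h := Fintype.card_le_of_injective g hg
  have hc : Fintype.card (Finset.Icc (-(N : ℤ)) N) = 2 * N + 1 := by
    rw [Fintype.card_coe, Int.card_Icc]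
    omega
  rwa [Fintype.card_fun, hc, Fintype.card_fin] at h

/-- The projection along `p` reduces this to Euclidean packing. It sends the ball of radius `R ≤ 1`
into radius `2 * R`, and it keeps separation `σ` because `2 * cosh σ - 2 ≥ σ ^ 2`. -/
theorem card_le_of_lorentz_separated {ι : Type*} [Fintype ι] {D N : ℕ}
    {p : Fin (D + 1) → ℝ} (hp : p ∈ lorentzSpace 1 D) {q : ι → Fin (D + 1) → ℝ}
    (hq : ∀ a, q a ∈ lorentzSpace 1 D) {σ R : ℝ} (hσ : 0 < σ) (hR0 : 0 ≤ R) (hR1 : R ≤ 1)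
    (hN : 2 * R * (D + 1) / σ ≤ N) (hb : ∀ a, -lorentzInner p (q a) ≤ cosh R)
    (hsep : ∀ a b, a ≠ b → cosh σ ≤ -lorentzInner (q a) (q b)) :
    Fintype.card ι ≤ (2 * N + 1) ^ D := by
  refine card_le_of_separated_of_bounded (fun a => boostSpatial p (q a)) hσ
    (R := 2 * R) (by positivity) hN ?_ ?_
  · intro a
    rw [sum_boostSpatial_sq hp, (hq a).1]
    have h1 := cosh_sq_sub_one_le hR0 hR1
    have h2 := one_le_neg_lorentzInner hp (hq a)
    have h3 : lorentzInner p (q a) ^ 2 ≤ cosh R ^ 2 := by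
      rw [← neg_sq]
      exact pow_le_pow_left₀ (by linarith) (hb a) 2
    linarith
  · intro a b hab
    simp only [← boostSpatial_sub]
    rw [sum_boostSpatial_sq hp]
    simp only [lorentzInner_sub_left, lorentzInner_sub_right, (hq a).1, (hq b).1,
      lorentzInner_comm (q b) (q a)]
    have h1 := hsep a b hab
    have h2 := one_add_half_sq_le_cosh σ
    nlinarith [sq_nonneg (lorentzInner p (q a) - lorentzInner p (q b))]

/-! ### The complete tree -/

/-- The empty word. -/
def treeRoot (m h : ℕ) : TreeNode m h := ⟨[], Nat.zero_le h⟩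

theorem completeTree_exists_walk {m h : ℕ} : ∀ (l : List (Fin m)) (hl : l.length ≤ h),
    ∃ w : (completeTree m h).Walk (treeRoot m h) ⟨l, hl⟩, w.length = l.length
  | [], _ => ⟨SimpleGraph.Walk.nil, rfl⟩
  | a :: l, hl => by
    have hl' : l.length ≤ h := by
      simp only [List.length_cons] at hl
      omega
    obtain ⟨w, hw⟩ := completeTree_exists_walk l hl'
    have hadj : (completeTree m h).Adj ⟨l, hl'⟩ ⟨a :: l, hl⟩ := Or.inl ⟨a, rfl⟩
    exact ⟨w.concat hadj, by rw [SimpleGraph.Walk.length_concat, hw, List.length_cons]⟩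

theorem completeTree_dist_root_le {m h : ℕ} (u : TreeNode m h) :
    (completeTree m h).dist (treeRoot m h) u ≤ u.1.length := by
  obtain ⟨w, hw⟩ := completeTree_exists_walk u.1 u.2
  exact hw ▸ SimpleGraph.dist_le w

theorem completeTree_reachable {m h : ℕ} (u v : TreeNode m h) :
    (completeTree m h).Reachable u v := by
  obtain ⟨w, -⟩ := completeTree_exists_walk u.1 u.2
  obtain ⟨w', -⟩ := completeTree_exists_walk v.1 v.2
  exact ⟨w.reverse.append w'⟩

theorem one_le_completeTree_dist {m h : ℕ} {u v : TreeNode m h} (huv : u ≠ v) :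
    1 ≤ (completeTree m h).dist u v :=
  (completeTree_reachable u v).pos_dist_of_ne huv

theorem two_le_completeTree_dist {m h : ℕ} {u v : TreeNode m h} (huv : u ≠ v)
    (hadj : ¬ (completeTree m h).Adj u v) : 2 ≤ (completeTree m h).dist u v := by
  have h1 := one_le_completeTree_dist huv
  have h2 : (completeTree m h).dist u v ≠ 1 := fun h => hadj (SimpleGraph.dist_eq_one_iff_adj.1 h)
  omega

/-- The depth of a word, with a negative sign unless the branch at the root is `b`. -/
def signedDepth {m : ℕ} (b : Fin m) (l : List (Fin m)) : ℤ :=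
  if l.getLast? = some b then l.length else -l.length

theorem signedDepth_cons_abs_sub_le {m : ℕ} (b a : Fin m) (l : List (Fin m)) :
    |signedDepth b (a :: l) - signedDepth b l| ≤ 1 := by
  rcases l with _ | ⟨c, l⟩
  · by_cases h : a = b <;> simp [signedDepth, h]
  · simp only [signedDepth, List.getLast?_cons_cons, List.length_cons]
    split_ifs <;> push_cast <;> rw [abs_le] <;> constructor <;> linarith

theorem abs_signedDepth_sub_le_length {m h : ℕ} (b : Fin m) {u v : TreeNode m h}
    (w : (completeTree m h).Walk u v) :
    |signedDepth b u.1 - signedDepth b v.1| ≤ w.length := by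
  induction w with
  | nil => simp
  | @cons u v z hadj w ih =>
    have h1 : |signedDepth b u.1 - signedDepth b v.1| ≤ 1 := by
      rcases hadj with ⟨a, ha⟩ | ⟨a, ha⟩
      · rw [ha, abs_sub_comm]
        exact signedDepth_cons_abs_sub_le b a u.1
      · rw [ha]
        exact signedDepth_cons_abs_sub_le b a v.1
    rw [SimpleGraph.Walk.length_cons]
    push_cast
    linarith [abs_sub_le (signedDepth b u.1) (signedDepth b v.1) (signedDepth b z.1)]

theorem exists_two_mul_le_completeTree_dist {m h : ℕ} (hm : 2 ≤ m) (hh : 1 ≤ h) :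
    ∃ u v : TreeNode m h, 2 * h ≤ (completeTree m h).dist u v := by
  let b : Fin m := ⟨0, by omega⟩
  let c : Fin m := ⟨1, by omega⟩
  have hcb : c ≠ b := by simp [b, c]
  let u : TreeNode m h := ⟨List.replicate h b, by simp⟩
  let v : TreeNode m h := ⟨List.replicate h c, by simp⟩
  refine ⟨u, v, ?_⟩
  obtain ⟨w, hw⟩ := (completeTree_reachable u v).exists_walk_length_eq_dist
  have h1 := (le_abs_self _).trans (abs_signedDepth_sub_le_length b w)
  have hne : h ≠ 0 := by omega
  have hu : signedDepth b u.1 = h := by simp [u, signedDepth, List.getLast?_replicate, hne]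
  have hv : signedDepth b v.1 = -h := by simp [v, signedDepth, List.getLast?_replicate, hne, hcb]
  rw [hu, hv] at h1
  omega

/-- A word of `k` binary digits as a node of the tree. -/
def binaryNode {m h k : ℕ} (hm : 2 ≤ m) (hk : k ≤ h) (e : Fin k → Fin 2) : TreeNode m h :=
  ⟨List.ofFn fun i => Fin.castLE hm (e i), by simpa using hk⟩

theorem binaryNode_injective {m h k : ℕ} (hm : 2 ≤ m) (hk : k ≤ h) :
    Function.Injective (binaryNode hm hk) := by
  intro e e' hee
  have h1 := List.ofFn_injective (congrArg Subtype.val hee)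
  funext i
  exact Fin.castLE_injective hm (congrFun h1 i)

/-! ### Lower bounds on the scale -/

theorem one_lt_scale {m h D : ℕ} (hm : 2 ≤ m) (hh : 2 ≤ h) {lam σ : ℝ} (hlam1 : 1 ≤ lam)
    (hlam : lam ≤ 11 / 10) (hσ : 0 < σ) {F : TreeNode m h → Fin (D + 1) → ℝ} (hF : ∀ v, F v ∈ lorentzSpace 1 D)
    (hd : ∀ u v, cosh (σ * (completeTree m h).dist u v) ≤ -lorentzInner (F u) (F v) ∧
      -lorentzInner (F u) (F v) ≤ cosh (lam * σ * (completeTree m h).dist u v)) : 1 < σ := by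
  let b : Fin m := ⟨0, by omega⟩
  let c : Fin m := ⟨1, by omega⟩
  have hbc : b ≠ c := by simp [b, c]
  -- The centre has depth one because for `m = 2` the root has only two neighbours.
  let p : TreeNode m h := ⟨[b], by simp; omega⟩
  let q₁ : TreeNode m h := ⟨[], by simp⟩
  let q₂ : TreeNode m h := ⟨[b, b], by simpa using hh⟩
  let q₃ : TreeNode m h := ⟨[c, b], by simpa using hh⟩
  have near : ∀ q, (completeTree m h).Adj p q → -lorentzInner (F p) (F q) ≤ cosh (11 / 10 * σ) := by
    intro q hq
    refine (hd p q).2.trans ?_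
    rw [SimpleGraph.dist_eq_one_iff_adj.2 hq, Nat.cast_one, mul_one, cosh_le_cosh,
      abs_of_nonneg (by positivity), abs_of_nonneg (by positivity)]
    exact mul_le_mul_of_nonneg_right hlam hσ.le
  have far : ∀ q q' : TreeNode m h, q ≠ q' → ¬ (completeTree m h).Adj q q' →
      cosh (2 * σ) ≤ -lorentzInner (F q) (F q') := by
    intro q q' hne hadj
    refine le_trans ?_ (hd q q').1
    rw [cosh_le_cosh, abs_of_nonneg (by positivity), abs_of_nonneg (by positivity), mul_comm]
    exact mul_le_mul_of_nonneg_left (by exact_mod_cast two_le_completeTree_dist hne hadj) hσ.le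
  refine one_lt_of_star hσ (hF p) (hF q₁) (hF q₂) (hF q₃) (near _ ?_) (near _ ?_) (near _ ?_)
    (far _ _ ?_ ?_) (far _ _ ?_ ?_) (far _ _ ?_ ?_)
  all_goals simp [completeTree, p, q₁, q₂, q₃, hbc]

theorem exists_pow_lt_two_pow (A B : ℝ) (D : ℕ) : ∃ k : ℕ, 1 ≤ k ∧ (A * k + B) ^ D < 2 ^ k := by
  have h1 : (fun k : ℕ => (A * k + B) ^ D) =o[Filter.atTop] fun k : ℕ => (2 : ℝ) ^ k := by
    have hlin : (fun k : ℕ => A * k + B) =O[Filter.atTop] fun k : ℕ => (k : ℝ) := by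
      refine (Asymptotics.isBigO_const_mul_self A _ _).add ?_
      exact (Asymptotics.isLittleO_const_left.2 (Or.inr
        (tendsto_norm_atTop_atTop.comp tendsto_natCast_atTop_atTop))).isBigO
    exact (hlin.pow D).trans_isLittleO (isLittleO_pow_const_const_pow_of_one_lt D one_lt_two)
  have h2 := h1.bound (c := 1 / 2) (by norm_num)
  obtain ⟨k, hk, hk1⟩ := (h2.and (Filter.eventually_ge_atTop 1)).exists
  refine ⟨k, hk1, (le_abs_self _).trans_lt ?_⟩
  simp only [norm_eq_abs] at hk
  have h3 : (0 : ℝ) < 2 ^ k := by positivity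
  rw [abs_of_pos h3] at hk
  linarith

theorem exists_le_scale {lam : ℝ} (hlam : 1 ≤ lam) (D : ℕ) :
    ∃ a : ℝ, 0 < a ∧ ∃ k : ℕ, ∀ m h : ℕ, 2 ≤ m → k ≤ h → ∀ σ : ℝ, 0 < σ →
      ∀ F : TreeNode m h → Fin (D + 1) → ℝ, (∀ v, F v ∈ lorentzSpace 1 D) →
      (∀ u v, cosh (σ * (completeTree m h).dist u v) ≤ -lorentzInner (F u) (F v) ∧
        -lorentzInner (F u) (F v) ≤ cosh (lam * σ * (completeTree m h).dist u v)) → a ≤ σ := by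
  -- The ratio of radius `lam * σ * k` to separation `σ` does not involve `σ`, so `k` depends only
  -- on `lam` and `D`. The `3` absorbs the rounding in `2 * ⌈·⌉₊ + 1`.
  obtain ⟨k, hk1, hk⟩ := exists_pow_lt_two_pow (4 * lam * (D + 1)) 3 D
  have hk0 : (0 : ℝ) < k := by exact_mod_cast hk1
  -- Below this value of `σ`, all words of length `k` land within distance `1` of the root, where
  -- the packing bound applies.
  refine ⟨1 / (lam * k), by positivity, k, fun m h hm hkh σ hσ F hF hd => ?_⟩
  by_contra! hlt
  rw [lt_div_iff₀ (by positivity)] at hlt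
  have hcard := card_le_of_lorentz_separated (N := ⌈2 * (lam * σ * k) * (D + 1) / σ⌉₊)
    (hF (treeRoot m h)) (q := fun e : Fin k → Fin 2 => F (binaryNode hm hkh e)) (fun e => hF _) hσ
    (R := lam * σ * k) (by positivity) (by linarith) (Nat.le_ceil _) ?_ ?_
  · rw [Fintype.card_fun, Fintype.card_fin, Fintype.card_fin] at hcard
    have h1 : 2 * (lam * σ * k) * (D + 1) / σ = 2 * lam * (D + 1) * k := by
      field_simp
    rw [h1] at hcard
    have h2 := Nat.ceil_lt_add_one (a := 2 * lam * (D + 1) * k) (by positivity)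
    have h3 : (2 : ℝ) ^ k ≤ (2 * (⌈2 * lam * (D + 1) * k⌉₊ : ℝ) + 1) ^ D := by exact_mod_cast hcard
    have h4 : (2 * (⌈2 * lam * (D + 1) * k⌉₊ : ℝ) + 1) ^ D ≤ (4 * lam * (D + 1) * k + 3) ^ D :=
      pow_le_pow_left₀ (by positivity) (by linarith) D
    linarith
  · intro e
    refine (hd _ _).2.trans ?_
    rw [cosh_le_cosh, abs_of_nonneg (by positivity), abs_of_nonneg (by positivity)]
    refine mul_le_mul_of_nonneg_left ?_ (by positivity)
    have := completeTree_dist_root_le (binaryNode hm hkh e)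
    simp only [binaryNode, List.length_ofFn] at this
    exact_mod_cast this
  · intro e e' hee
    refine le_trans ?_ (hd _ _).1
    rw [cosh_le_cosh, abs_of_nonneg hσ.le, abs_of_nonneg (by positivity)]
    have := one_le_completeTree_dist ((binaryNode_injective hm hkh).ne hee)
    exact le_mul_of_one_le_right hσ.le (by exact_mod_cast this)

/-! ### The reach of the layer after bounded updates -/

theorem norm_le_of_updates {E : Type*} [NormedAddCommGroup E] {W : ℕ → E} {ω δ : ℝ} {n : ℕ}
    (h0 : ‖W 0‖ ≤ ω) (hW : ∀ t < n, ‖W (t + 1) - W t‖ ≤ δ) : ‖W n‖ ≤ ω + n * δ := by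
  induction n with
  | zero => simpa using h0
  | succ n ih =>
    have h1 := ih fun t ht => hW t (by omega)
    have h2 := hW n (by omega)
    have h3 := norm_add_le (W n) (W (n + 1) - W n)
    rw [add_sub_cancel] at h3
    push_cast
    linarith

theorem sum_mulVec_sq_le {m n : ℕ} (W : Matrix (Fin m) (Fin n) ℝ) (x : Fin n → ℝ) :
    ∑ i, (W.mulVec x i) ^ 2 ≤ ‖W‖ ^ 2 * ∑ j, x j ^ 2 := by
  have hn : ‖W‖ ^ 2 = ∑ i, ∑ j, W i j ^ 2 := by
    rw [Matrix.frobenius_norm_def, ← sqrt_eq_rpow, sq_sqrt (by positivity)]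
    simp
  rw [hn, Finset.sum_mul]
  refine Finset.sum_le_sum fun i _ => ?_
  simpa only [Matrix.mulVec, dotProduct] using
    Finset.sum_mul_sq_le_sq_mul_sq Finset.univ (W i) x

/-- `√κ * x 0` is the `cosh` of the rescaled distance to the origin, and the spatial norm is below
the time coordinate. -/
theorem sum_sq_le_of_lorentzDist_origin_le {κ r : ℝ} (hκ : 0 < κ) {D : ℕ} {x : Fin (D + 1) → ℝ}
    (hx : x ∈ lorentzSpace κ D) (hr : lorentzDist κ x (lorentzOrigin κ D) ≤ r) :
    κ * ∑ i, x i ^ 2 ≤ 2 * cosh (√κ * r) ^ 2 := by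
  have h1 := neg_lorentzInner_eq_cosh hκ hx (lorentzOrigin_mem hκ D)
  have hd := lorentzDist_nonneg hκ hx (lorentzOrigin_mem hκ D)
  have hk := sqrt_pos.2 hκ
  have h2 : cosh (√κ * lorentzDist κ x (lorentzOrigin κ D)) ≤ cosh (√κ * r) := by
    rw [cosh_le_cosh, abs_of_nonneg (by positivity)]
    exact (mul_le_mul_of_nonneg_left hr hk.le).trans (le_abs_self _)
  have h3 : -lorentzInner (√κ • x) (√κ • lorentzOrigin κ D) = √κ * x 0 := by
    simp only [lorentzInner, lorentzOrigin, Pi.smul_apply, Fin.cons_zero, Fin.cons_succ,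
      Pi.zero_apply, smul_eq_mul, mul_zero, Finset.sum_const_zero]
    field_simp
    ring
  have h4 : √κ * x 0 ≤ cosh (√κ * r) := by linarith
  have h5 : κ * x 0 ^ 2 ≤ cosh (√κ * r) ^ 2 := by
    have := pow_le_pow_left₀ (mul_pos hk hx.2).le h4 2
    rwa [mul_pow, sq_sqrt hκ.le] at this
  have h6 := hx.1
  simp only [lorentzInner] at h6
  have h7 : ∑ i : Fin D, x i.succ ^ 2 ≤ x 0 ^ 2 := by
    simp only [pow_two]
    have : -1 / κ < 0 := div_neg_of_neg_of_pos (by norm_num) hκ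
    linarith
  rw [Fin.sum_univ_succ]
  nlinarith

theorem chenLayer_time_sq_le {κ r K : ℝ} (hκ : 0 < κ) {Din Dout : ℕ}
    {W : Matrix (Fin Dout) (Fin (Din + 1)) ℝ} (hW : ‖W‖ ≤ K) {x : Fin (Din + 1) → ℝ}
    (hx : x ∈ lorentzSpace κ Din) (hr : lorentzDist κ x (lorentzOrigin κ Din) ≤ r) :
    (√κ * chenLayer κ W x 0) ^ 2 ≤ (1 + 2 * cosh (√κ * r) * K) ^ 2 := by
  have hK : 0 ≤ K := (norm_nonneg _).trans hW
  have h1 := sum_mulVec_sq_le W x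
  have h2 := sum_sq_le_of_lorentzDist_origin_le hκ hx hr
  have h3 : ‖W‖ ^ 2 ≤ K ^ 2 := pow_le_pow_left₀ (norm_nonneg _) hW 2
  have h0 : 0 ≤ ∑ i, (W.mulVec x i) ^ 2 := Finset.sum_nonneg fun i _ => sq_nonneg _
  have hc := cosh_pos (√κ * r)
  rw [mul_pow, sq_sqrt hκ.le]
  simp only [chenLayer, Fin.cons_zero]
  rw [sq_sqrt (by positivity), mul_add, mul_one_div_cancel hκ.ne']
  have h4 : κ * ∑ i, (W.mulVec x i) ^ 2 ≤ K ^ 2 * (2 * cosh (√κ * r) ^ 2) :=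
    calc κ * ∑ i, (W.mulVec x i) ^ 2 ≤ κ * (‖W‖ ^ 2 * ∑ j, x j ^ 2) :=
          mul_le_mul_of_nonneg_left h1 hκ.le
      _ = ‖W‖ ^ 2 * (κ * ∑ j, x j ^ 2) := by ring
      _ ≤ K ^ 2 * (2 * cosh (√κ * r) ^ 2) := mul_le_mul h3 h2 (by positivity) (by positivity)
  nlinarith [mul_nonneg hc.le hK, sq_nonneg (K * cosh (√κ * r))]

theorem exp_le_of_scale {κ r K σ : ℝ} (hκ : 0 < κ) (hσ : 0 < σ) {m h Din Dout : ℕ} (hm : 2 ≤ m)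
    (hh : 1 ≤ h) {W : Matrix (Fin Dout) (Fin (Din + 1)) ℝ} (hW : ‖W‖ ≤ K)
    {x : TreeNode m h → Fin (Din + 1) → ℝ}
    (hx : ∀ v, x v ∈ lorentzSpace κ Din ∧ lorentzDist κ (x v) (lorentzOrigin κ Din) ≤ r)
    (hd : ∀ u v, cosh (σ * (completeTree m h).dist u v) ≤
      -lorentzInner (√κ • chenLayer κ W (x u)) (√κ • chenLayer κ W (x v))) :
    exp (σ * h) ≤ 2 * (1 + 2 * cosh (√κ * r) * K) := by
  obtain ⟨u, v, huv⟩ := exists_two_mul_le_completeTree_dist hm hh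
  have hK : 0 ≤ K := (norm_nonneg _).trans hW
  have hc := cosh_pos (√κ * r)
  have hB : 0 ≤ 1 + 2 * cosh (√κ * r) * K := by positivity
  have htime : ∀ v, √κ * chenLayer κ W (x v) 0 ≤ 1 + 2 * cosh (√κ * r) * K := fun v =>
    (abs_le_of_sq_le_sq' (chenLayer_time_sq_le hκ hW (hx v).1 (hx v).2) hB).2
  have hpos : ∀ v, 0 ≤ √κ * chenLayer κ W (x v) 0 := fun v =>
    mul_nonneg (sqrt_nonneg κ) (chenLayer_mem hκ W (x v)).2.le
  have h1 := neg_lorentzInner_le (sqrt_smul_mem_lorentzSpace hκ (chenLayer_mem hκ W (x u)))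
    (sqrt_smul_mem_lorentzSpace hκ (chenLayer_mem hκ W (x v)))
  simp only [Pi.smul_apply, smul_eq_mul] at h1
  have h2 := mul_le_mul (htime u) (htime v) (hpos v) hB
  have h3 : cosh (σ * (2 * h)) ≤ cosh (σ * (completeTree m h).dist u v) := by
    rw [cosh_le_cosh, abs_of_nonneg (by positivity), abs_of_nonneg (by positivity)]
    exact mul_le_mul_of_nonneg_left (by exact_mod_cast huv) hσ.le
  -- The diameter `2 * h` is shared by two time coordinates, so a square root leaves exponent `σ *
  -- h`.
  have h4 : exp (σ * h) ^ 2 = exp (σ * (2 * h)) := by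
    rw [← exp_nat_mul]
    congr 1
    push_cast
    ring
  have h5 : exp (σ * (2 * h)) ≤ 2 * cosh (σ * (2 * h)) := by
    rw [cosh_eq]
    linarith [exp_pos (-(σ * (2 * h)))]
  refine (abs_le_of_sq_le_sq' ?_ (by positivity)).2
  linarith [hd u v]

theorem exists_updates_lower_bound {κ δ : ℝ} (ω r : ℝ) (hδ : 0 < δ) {a : ℝ} (ha : 0 < a) :
    ∃ c : ℝ, 0 < c ∧ ∃ h₀ : ℕ, ∀ h n : ℕ, h₀ ≤ h →
      exp (a * h) ≤ 2 * (1 + 2 * cosh (√κ * r) * (ω + n * δ)) → c * exp (a * h) ≤ n := by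
  have hc := cosh_pos (√κ * r)
  set A := 2 * (1 + 2 * cosh (√κ * r) * ω) with hA
  set B := 4 * cosh (√κ * r) * δ with hB
  have hB0 : 0 < B := by positivity
  -- From this depth on, the constant `A` is at most half of the exponential.
  obtain ⟨h₀, hh₀⟩ := exists_nat_ge (2 * A / a)
  refine ⟨1 / (2 * B), by positivity, h₀, fun h n hh hle => ?_⟩
  have h1 : 2 * A ≤ exp (a * h) := by
    have h2 : 2 * A / a ≤ h := hh₀.trans (by exact_mod_cast hh)
    rw [div_le_iff₀ ha] at h2
    linarith [add_one_le_exp (a * h)]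
  have h3 : exp (a * h) ≤ A + B * n := by
    rw [hA, hB]
    linarith
  rw [div_mul_eq_mul_div, one_mul, div_le_iff₀ (by positivity)]
  linarith

theorem mainTheorem2 :
    (∀ κ δ ω r : ℝ, 0 < κ → 0 < δ →
      ∃ c : ℝ, 0 < c ∧ ∃ h₀ : ℕ, ∀ lam : ℝ, 1 ≤ lam → lam ≤ 11 / 10 →
        ∀ Din Dout m h n : ℕ, 2 ≤ m → h₀ ≤ h →
          ChenEmbedsTree κ δ ω r lam Din Dout m h n → c * Real.exp (h : ℝ) ≤ (n : ℝ)) ∧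
    (∀ (lam : ℝ) (Dout : ℕ), 1 ≤ lam →
      ∃ a : ℝ, 0 < a ∧ ∀ κ δ ω r : ℝ, 0 < κ → 0 < δ →
        ∃ c : ℝ, 0 < c ∧ ∃ h₀ : ℕ, ∀ Din m h n : ℕ, 2 ≤ m → h₀ ≤ h →
          ChenEmbedsTree κ δ ω r lam Din Dout m h n →
            c * Real.exp (a * (h : ℝ)) ≤ (n : ℝ)) := by
  constructor
  · intro κ δ ω r hκ hδ
    obtain ⟨c, hc, h₀, H⟩ := exists_updates_lower_bound (κ := κ) ω r hδ one_pos
    -- Depth `2` makes room for the three-leaf star.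
    refine ⟨c, hc, max h₀ 2, fun lam hl1 hl Din Dout m h n hm hh => ?_⟩
    rintro ⟨W, x, hW0, hW, hx, hdist⟩
    obtain ⟨σ, hσ, hd⟩ := hdist.exists_scale hκ fun v => chenLayer_mem hκ _ _
    have h2 : 2 ≤ h := (le_max_right _ _).trans hh
    have h1σ := one_lt_scale hm h2 hl1 hl hσ
      (fun v => sqrt_smul_mem_lorentzSpace hκ (chenLayer_mem hκ (W n) (x v))) hd
    have key := exp_le_of_scale hκ hσ hm (by omega) (norm_le_of_updates hW0 hW) hx
      fun u v => (hd u v).1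
    have := H h n ((le_max_left _ _).trans hh) ((exp_le_exp.2
      (mul_le_mul_of_nonneg_right h1σ.le (Nat.cast_nonneg h))).trans key)
    rwa [one_mul] at this
  · intro lam Dout hlam
    obtain ⟨a, ha, k, hk⟩ := exists_le_scale hlam Dout
    refine ⟨a, ha, fun κ δ ω r hκ hδ => ?_⟩
    obtain ⟨c, hc, h₀, H⟩ := exists_updates_lower_bound (κ := κ) ω r hδ ha
    refine ⟨c, hc, max h₀ (max k 1), fun Din m h n hm hh => ?_⟩
    rintro ⟨W, x, hW0, hW, hx, hdist⟩
    obtain ⟨σ, hσ, hd⟩ := hdist.exists_scale hκ fun v => chenLayer_mem hκ _ _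
    have haσ := hk m h hm (by omega) σ hσ _
      (fun v => sqrt_smul_mem_lorentzSpace hκ (chenLayer_mem hκ (W n) (x v))) hd
    have key := exp_le_of_scale hκ hσ hm (by omega) (norm_le_of_updates hW0 hW) hx
      fun u v => (hd u v).1
    exact H h n ((le_max_left _ _).trans hh) ((exp_le_exp.2
      (mul_le_mul_of_nonneg_right haσ (Nat.cast_nonneg h))).trans key)
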